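/- Let $K$ be a field that is complete for a discrete valuation $\mathrm{val}\colon K^\times\to\mathbb{Z}$ having a uniformizer $\pi$ with $\mathrm{val}(\pi)=1$, and let $K[\mathbf X]=K[X_1,\dots,X_n]$. For $\mathbf r\in\mathbb{Q}^n$ put $\mathrm{val}_{\mathbf r}(a\mathbf X^{\mathbf i})=\mathrm{val}(a)-\mathbf r\cdot\mathbf i$ for $a \neq 0$, and let $K\{\mathbf X;\mathbf r\}$ be the Tate algebra of the power series $\sum a_{\mathbf i}\mathbf X^{\mathbf i}$ with $\mathrm{val}(a_{\mathbf i})-\mathbf r\cdot\mathbf i\to+\infty$ as $|\mathbf i|\to\infty$. For a monomial order $<_m$ (the tie-break order), write $a\mathbf X^{\mathbf i}<_{\mathbf r,m}b\mathbf X^{\mathbf j}$ (with $a,b\in K^\times$) if $\mathrm{val}_{\mathbf r}(a\mathbf X^{\mathbf i})>\mathrm{val}_{\mathbf r}(b\mathbf X^{\mathbf j})$, or if these are equal and $\mathbf X^{\mathbf i}<_m\mathbf X^{\mathbf j}$. For $f \neq 0$ in $K\{\mathbf X;\mathbf r\}$ let $\mathrm{LT}_{\mathbf r,m}(f)$ be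 its largest term, and put $\mathrm{LT}_{\mathbf r,m}(0)=0$. For a polynomial $f$ let $\mathrm{in}_{\mathbf r}(f)$ be the sum of its terms of minimal $\mathrm{val}_{\mathbf r}$. For an ideal $I\subseteq K[\mathbf X]$ let $I_{\mathbf r}$ be the ideal of $K\{\mathbf X;\mathbf r\}$ generated by $I$, and let $\mathrm{LT}_{\mathbf r,m}(I)$ be the ideal of $K[\mathbf X]$ generated by $\{\mathrm{LT}_{\mathbf r,m}(f): f\in I\}$. A set $G\subseteq K[\mathbf X]$ is a local Gröbner basis of $I$ with respect to $<_{\mathbf r,m}$ if $G\subseteq I_{\mathbf r}$ and for every nonzero $f\in I_{\mathbf r}$ there is $g\in G$ such that $\mathrm{LT}_{\mathbf r,m}(g)$ divides $\mathrm{LT}_{\mathbf r,m}(f)$. Two orders $<_{\mathbf r,m_1}$ and $<_{\mathbf s,m_2}$ are equivalent with respect to $I$ if $\{\mathrm{LT}_{\mathbf r,m_1}(f): f\in I\}=\{\mathrm{LT}_{\mathbf s,m_2}(f): f\in I\}$. Let $I\subseteq K[\mathbf X]$ be an ideal and $G\subseteq K[\mathbf X]$. (1) If $G$ is a local Gröbner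 basis of $I$ with respect to $<_{\mathbf r,m_1}$, then there is $\mathbf s\in\mathbb{Q}^n$ such that for every monomial order $<_{m_2}$: (a) $G$ is a local Gröbner basis of $I$ with respect to $<_{\mathbf s,m_2}$; (b) $<_{\mathbf r,m_1}$ and $<_{\mathbf s,m_2}$ are equivalent with respect to $I$; (c) $\mathrm{LT}_{\mathbf s,m_2}(I)=\langle \mathrm{in}_{\mathbf s}(f): f\in I\rangle$. (2) Suppose that $G$ is a universal analytic Gröbner basis of $I$, that is, $G$ is a finite subset of $I$ and, for every $\mathbf r\in\mathbb{Q}^n$, a local Gröbner basis of $I$ with respect to $<_{\mathbf r,m_{\mathbf r}}$ for some tie-break order $m_{\mathbf r}$ (for instance one fixed order for all $\mathbf r$). Then for every $\mathbf r\in\mathbb{Q}^n$ and every monomial order $<_{m}$, $G$ is a local Gröbner basis of $I$ with respect to $<_{\mathbf r,m}$. -/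

import Mathlib

open scoped WithZero

namespace TateGB

noncomputable section

section Field

variable {K : Type*} [Field K] [Valued K ℤᵐ⁰]

/-- The additive valuation `val a ∈ ℤ` of a nonzero `a : K`
(the value at `0` is a placeholder which no definition below uses). -/
def val (a : K) : ℤ := -WithZero.log (Valued.v a)

variable {n : ℕ}

/-- The Gauss valuation `val a - r · i` of the term `a X^i`, for `a ≠ 0`. -/
def termVal (r : Fin n → ℚ) (a : K) (i : Fin n →₀ ℕ) : ℚ :=
  (val a : ℚ) - ∑ k, r k * (i k : ℚ)

/-- The convergence condition `val (a_i) - r · i → +∞` as `|i| → +∞`: below any bound there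
are only finitely many terms (a zero coefficient has valuation `+∞`). -/
def Converges (r : Fin n → ℚ) (f : MvPowerSeries (Fin n) K) : Prop :=
  ∀ B : ℚ, {i | MvPowerSeries.coeff i f ≠ 0 ∧ termVal r (MvPowerSeries.coeff i f) i ≤ B}.Finite

theorem val_mul {a b : K} (ha : a ≠ 0) (hb : b ≠ 0) : val (a * b) = val a + val b := by
  have h1 : Valued.v a ≠ 0 := (Valuation.ne_zero_iff _).2 ha
  have h2 : Valued.v b ≠ 0 := (Valuation.ne_zero_iff _).2 hb
  simp only [val, map_mul, WithZero.log_mul h1 h2]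
  ring

theorem val_neg (a : K) : val (-a) = val a := by simp [val]

theorem val_le_val {a b : K} (ha : a ≠ 0) (h : Valued.v a ≤ Valued.v b) : val b ≤ val a := by
  have h1 : Valued.v a ≠ 0 := (Valuation.ne_zero_iff _).2 ha
  simp only [val, neg_le_neg_iff]
  exact (WithZero.log_le_log h1 (ne_of_gt (lt_of_lt_of_le (zero_lt_iff.2 h1) h))).2 h

/-- A nonzero sum has a nonzero summand of at most the same valuation. -/
theorem exists_val_le {ι : Type*} (s : Finset ι) (u : ι → K) (h : ∑ p ∈ s, u p ≠ 0) :
    ∃ p ∈ s, u p ≠ 0 ∧ val (u p) ≤ val (∑ q ∈ s, u q) := by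
  have h0 : Valued.v (∑ q ∈ s, u q) ≠ 0 := (Valuation.ne_zero_iff _).2 h
  by_contra! hc
  refine lt_irrefl (Valued.v (∑ q ∈ s, u q)) (Valuation.map_sum_lt _ h0 fun p hp => ?_)
  by_cases hu : u p = 0
  · rw [hu, map_zero]
    exact zero_lt_iff.2 h0
  · by_contra! hle
    exact absurd (val_le_val h hle) (not_le.2 (hc p hp hu))

theorem Converges.bddBelow {r : Fin n → ℚ} {f : MvPowerSeries (Fin n) K} (hf : Converges r f) :
    ∃ L : ℚ, ∀ i, MvPowerSeries.coeff i f ≠ 0 → L ≤ termVal r (MvPowerSeries.coeff i f) i := by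
  obtain ⟨L, hL⟩ := ((hf 0).image fun i => termVal r (MvPowerSeries.coeff i f) i).bddBelow
  refine ⟨min L 0, fun i hi => ?_⟩
  by_cases h : termVal r (MvPowerSeries.coeff i f) i ≤ 0
  · exact (min_le_left _ _).trans (hL ⟨i, ⟨hi, h⟩, rfl⟩)
  · exact (min_le_right _ _).trans (not_le.1 h).le

theorem Converges.mul {r : Fin n → ℚ} {f g : MvPowerSeries (Fin n) K} (hf : Converges r f)
    (hg : Converges r g) : Converges r (f * g) := by
  intro B
  obtain ⟨L, hL⟩ := hf.bddBelow
  obtain ⟨M, hM⟩ := hg.bddBelow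
  refine (Set.Finite.image2 (fun i j => i + j) (hf (B - M)) (hg (B - L))).subset ?_
  rintro k ⟨hk, hkB⟩
  rw [MvPowerSeries.coeff_mul] at hk hkB
  obtain ⟨⟨i, j⟩, hp, hne, hle⟩ := exists_val_le _ _ hk
  obtain ⟨hi, hj⟩ := mul_ne_zero_iff.1 hne
  rw [Finset.HasAntidiagonal.mem_antidiagonal] at hp
  have hsum : termVal r (MvPowerSeries.coeff i f) i + termVal r (MvPowerSeries.coeff j g) j ≤ B := by
    refine le_trans ?_ hkB
    have h2 : ((val (MvPowerSeries.coeff i f) : ℚ) + val (MvPowerSeries.coeff j g)) ≤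
        val (∑ p ∈ Finset.HasAntidiagonal.antidiagonal k,
          MvPowerSeries.coeff p.1 f * MvPowerSeries.coeff p.2 g) := by
      rw [val_mul hi hj] at hle
      exact_mod_cast hle
    subst hp
    simp only [termVal, Finsupp.add_apply, Nat.cast_add, mul_add, Finset.sum_add_distrib]
    linarith
  have h3 := hL i hi
  have h4 := hM j hj
  exact ⟨i, ⟨hi, by linarith⟩, j, ⟨hj, by linarith⟩, hp⟩

theorem Converges.add {r : Fin n → ℚ} {f g : MvPowerSeries (Fin n) K} (hf : Converges r f)
    (hg : Converges r g) : Converges r (f + g) := by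
  intro B
  refine ((hf B).union (hg B)).subset ?_
  rintro i ⟨hi, hB⟩
  have e : MvPowerSeries.coeff i (f + g) =
      ∑ b : Bool, (if b then MvPowerSeries.coeff i f else MvPowerSeries.coeff i g) := by simp
  rw [e] at hi hB
  obtain ⟨b, -, hb, hle⟩ := exists_val_le _ _ hi
  have h2 : termVal r (if b then MvPowerSeries.coeff i f else MvPowerSeries.coeff i g) i ≤ B := by
    refine le_trans ?_ hB
    simp only [termVal]
    gcongr
  cases b
  · exact Or.inr ⟨by simpa using hb, by simpa using h2⟩
  · exact Or.inl ⟨by simpa using hb, by simpa using h2⟩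

theorem Converges.neg {r : Fin n → ℚ} {f : MvPowerSeries (Fin n) K} (hf : Converges r f) :
    Converges r (-f) := by
  intro B
  simpa [termVal, val_neg] using hf B

theorem converges_coe (r : Fin n → ℚ) (p : MvPolynomial (Fin n) K) :
    Converges r (p : MvPowerSeries (Fin n) K) := by
  intro B
  refine p.support.finite_toSet.subset ?_
  rintro i ⟨hi, -⟩
  simpa using hi

variable (K) in
/-- The Tate algebra `K{X; r}` with convergence log-radii `r`. -/
def tateAlgebra (r : Fin n → ℚ) : Subring (MvPowerSeries (Fin n) K) where
  carrier := {f | Converges r f}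
  mul_mem' := Converges.mul
  one_mem' := by simpa using converges_coe (K := K) r 1
  add_mem' := Converges.add
  zero_mem' := by simpa using converges_coe (K := K) r 0
  neg_mem' := Converges.neg

/-- The inclusion `K[X] → K{X; r}`. -/
def polyToTate (r : Fin n → ℚ) : MvPolynomial (Fin n) K →+* tateAlgebra K r :=
  (MvPolynomial.coeToMvPowerSeries.ringHom).codRestrict (tateAlgebra K r) (converges_coe r)

/-- `I_r`, the ideal of `K{X; r}` generated by the polynomials of `I`. -/
def completedIdeal (r : Fin n → ℚ) (I : Ideal (MvPolynomial (Fin n) K)) :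
    Ideal (tateAlgebra K r) :=
  I.map (polyToTate r)

/-- The strict order `a X^i <_{r,m} b X^j` on terms with nonzero coefficients. -/
def TermLT (r : Fin n → ℚ) (m : MonomialOrder (Fin n)) (a : K) (i : Fin n →₀ ℕ)
    (b : K) (j : Fin n →₀ ℕ) : Prop :=
  termVal r b j < termVal r a i ∨ (termVal r a i = termVal r b j ∧ m.toSyn i < m.toSyn j)

/-- `i` is the exponent of the `<_{r,m}`-largest term of `f`. -/
def IsLeadingExponent (r : Fin n → ℚ) (m : MonomialOrder (Fin n))
    (f : MvPowerSeries (Fin n) K) (i : Fin n →₀ ℕ) : Prop :=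
  MvPowerSeries.coeff i f ≠ 0 ∧ ∀ j, j ≠ i → MvPowerSeries.coeff j f ≠ 0 →
    TermLT r m (MvPowerSeries.coeff j f) j (MvPowerSeries.coeff i f) i

theorem IsLeadingExponent.unique {r : Fin n → ℚ} {m : MonomialOrder (Fin n)}
    {f : MvPowerSeries (Fin n) K} {i j : Fin n →₀ ℕ} (hi : IsLeadingExponent r m f i)
    (hj : IsLeadingExponent r m f j) : i = j := by
  by_contra hne
  rcases hi.2 j (Ne.symm hne) hj.1 with h | ⟨h, h'⟩ <;>
    rcases hj.2 i hne hi.1 with k | ⟨k, k'⟩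
  · exact lt_asymm h k
  · exact absurd k (ne_of_lt h)
  · exact absurd h (ne_of_lt k)
  · exact lt_asymm h' k'

theorem exists_isLeadingExponent (r : Fin n → ℚ) (m : MonomialOrder (Fin n))
    {f : MvPowerSeries (Fin n) K} (hf : Converges r f) (h0 : f ≠ 0) :
    ∃ i, IsLeadingExponent r m f i := by
  obtain ⟨i₀, hi₀⟩ : ∃ i, MvPowerSeries.coeff i f ≠ 0 := by
    by_contra! h
    exact h0 (MvPowerSeries.ext h)
  set t : (Fin n →₀ ℕ) → ℚ := fun i => termVal r (MvPowerSeries.coeff i f) i with ht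
  obtain ⟨i₁, ⟨hi₁, hi₁'⟩, hmin⟩ := Set.exists_min_image _ t (hf (t i₀)) ⟨i₀, hi₀, le_rfl⟩
  have hmin' : ∀ j, MvPowerSeries.coeff j f ≠ 0 → t i₁ ≤ t j := by
    intro j hj
    by_cases h : t j ≤ t i₀
    · exact hmin j ⟨hj, h⟩
    · exact hi₁'.trans (not_le.1 h).le
  obtain ⟨i, ⟨hi, hi'⟩, hmax⟩ := Set.exists_max_image _ m.toSyn (hf (t i₁)) ⟨i₁, hi₁, le_rfl⟩
  refine ⟨i, hi, fun j hji hj => ?_⟩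
  have e : t i = t i₁ := le_antisymm hi' (hmin' i hi)
  rcases (hmin' j hj).lt_or_eq with h | h
  · exact Or.inl (by rw [← e] at h; exact h)
  · refine Or.inr ⟨by rw [← e] at h; exact h.symm, lt_of_le_of_ne (hmax j ⟨hj, h.ge⟩) ?_⟩
    exact fun h => hji (m.toSyn.injective h)

open Classical in
/-- The leading term `LT_{r,m}(f)`, as an element of `K[X]`; it is `0` for `f = 0`. -/
def leadingTerm (r : Fin n → ℚ) (m : MonomialOrder (Fin n)) (f : MvPowerSeries (Fin n) K) :
    MvPolynomial (Fin n) K :=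
  if h : ∃ i, IsLeadingExponent r m f i then
    MvPolynomial.monomial h.choose (MvPowerSeries.coeff h.choose f)
  else 0

/-- `G` is a Gröbner basis of the ideal `J` of `K{X; r}` with respect to `<_{r,m}`. -/
def IsGroebnerBasis (r : Fin n → ℚ) (m : MonomialOrder (Fin n)) (J : Ideal (tateAlgebra K r))
    (G : Set (tateAlgebra K r)) : Prop :=
  G ⊆ J ∧ ∀ f ∈ J, f ≠ 0 → ∃ g ∈ G,
    leadingTerm r m (g : MvPowerSeries (Fin n) K) ∣ leadingTerm r m (f : MvPowerSeries (Fin n) K)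

/-- `G` is an `r`-local Gröbner basis of `I` (with tie-break order `m`): a set of polynomials
which is a Gröbner basis of `I_r`. -/
def IsLocalGroebnerBasis (r : Fin n → ℚ) (m : MonomialOrder (Fin n))
    (I : Ideal (MvPolynomial (Fin n) K)) (G : Set (MvPolynomial (Fin n) K)) : Prop :=
  IsGroebnerBasis r m (completedIdeal r I) (polyToTate r '' G)

/-- `G` is a universal analytic Gröbner basis of `I`, where `m r` is the order used for breaking
ties at the log-radii `r` (one fixed tie-break order being the case of a constant `m`). -/
def IsUniversalAnalyticGroebnerBasis (m : (Fin n → ℚ) → MonomialOrder (Fin n))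
    (I : Ideal (MvPolynomial (Fin n) K)) (G : Set (MvPolynomial (Fin n) K)) : Prop :=
  G.Finite ∧ G ⊆ I ∧ ∀ r : Fin n → ℚ, IsLocalGroebnerBasis r (m r) I G

/-- The set `{LT_{r,m}(f) : f ∈ I}` of leading terms of the polynomials in `I`. -/
def leadingTerms (r : Fin n → ℚ) (m : MonomialOrder (Fin n))
    (I : Ideal (MvPolynomial (Fin n) K)) : Set (MvPolynomial (Fin n) K) :=
  (fun f : MvPolynomial (Fin n) K => leadingTerm r m (f : MvPowerSeries (Fin n) K)) '' I

/-- `LT_{r,m}(I)`, the ideal of `K[X]` generated by the leading terms of `I`. -/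
def leadingIdeal (r : Fin n → ℚ) (m : MonomialOrder (Fin n))
    (I : Ideal (MvPolynomial (Fin n) K)) : Ideal (MvPolynomial (Fin n) K) :=
  Ideal.span (leadingTerms r m I)

/-- `<_{r,m₁}` and `<_{s,m₂}` are equivalent with respect to `I`. -/
def OrdersEquivalent (r : Fin n → ℚ) (m₁ : MonomialOrder (Fin n)) (s : Fin n → ℚ)
    (m₂ : MonomialOrder (Fin n)) (I : Ideal (MvPolynomial (Fin n) K)) : Prop :=
  leadingTerms r m₁ I = leadingTerms s m₂ I

open Classical in
/-- The initial part `in_r(f)` of a polynomial: the sum of its terms of minimal Gauss valuation. -/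
def initialPart (r : Fin n → ℚ) (f : MvPolynomial (Fin n) K) : MvPolynomial (Fin n) K :=
  ∑ i ∈ f.support with ∀ j ∈ f.support, termVal r (f.coeff i) i ≤ termVal r (f.coeff j) j,
    MvPolynomial.monomial i (f.coeff i)

/-- `⟨in_r(f) : f ∈ I⟩`. -/
def initialIdeal (r : Fin n → ℚ) (I : Ideal (MvPolynomial (Fin n) K)) :
    Ideal (MvPolynomial (Fin n) K) :=
  Ideal.span (initialPart r '' I)

end Field

end

end TateGB

/-! The tie-break order can be absorbed into the log-radii. On a finite set of exponents, a monomial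
order agrees with a rational weight `w ≥ 0` (`exists_weight`). Replacing `r` by `s = r + ε w` with
small `ε > 0` keeps the strict inequalities of Gauss valuations among finitely many terms and breaks
ties as the order does. So finitely many polynomials keep their leading exponents and have a single
term of minimal valuation at `s` (`exists_strictLead`); from then on no tie-break matters.

For (1), Dickson's lemma gives a finite set `A` generating the leading exponents at `r`. Each `a ∈
A` is realised by some `g a ∈ G` and, by density of `I` in `I_r`, by some `p a ∈ I`; choose `s` for
all of these. Since `r ≤ s`, series convergent at `s` converge at `r`. Divide such a series lying in
`I_r` by the `p a` inside `K{X; s}`: the remainder is in `I_r` with no exponent above `A`, hence is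
zero. Thus the series is in `I_s`. The division also raises valuations by a fixed `δ`, so all
minimal terms of the series lie above `A` (`mem_completedIdeal_of_restrict`). The three claims
follow, because everything at `s` is governed by `A`.

For (2), replace an element of `I_r` by a polynomial of `I` with the same leading exponent, absorb
the new tie-break for it and the finite set `G`, use the Gröbner property at `s`, and return to `r`.
-/

namespace TateGB

/-! ### Rational weights for monomial orders, and Dickson's lemma -/

section Combinatorics

/-- A finite subset of a set of integer vectors that is closed under addition and omits zero lies
in an open half-space with rational normal vector. -/
theorem exists_weight_pos : ∀ {n : ℕ} (P : Set (Fin n → ℤ)), (∀ u ∈ P, ∀ v ∈ P, u + v ∈ P) →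
    (0 : Fin n → ℤ) ∉ P → ∀ S : Set (Fin n → ℤ), S.Finite → S ⊆ P →
    ∃ w : Fin n → ℚ, ∀ v ∈ S, 0 < ∑ k, w k * (v k : ℚ) := by
  intro n
  induction n with
  | zero =>
    intro P _ h0 S _ hSP
    refine ⟨fun _ => 0, fun v hv => absurd (hSP hv) ?_⟩
    rwa [Subsingleton.elim v 0]
  | succ n ih =>
    intro P hadd h0 S hS hSP
    have hsmul : ∀ v ∈ P, ∀ k : ℕ, (k + 1) • v ∈ P := by
      intro v hv k
      induction k with
      | zero => simpa using hv
      | succ k ihk => rw [succ_nsmul]; exact hadd _ ihk _ hv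
    have hsmulZ : ∀ v ∈ P, ∀ c : ℤ, 0 < c → c • v ∈ P := by
      intro v hv c hc
      obtain ⟨k, rfl⟩ : ∃ k : ℕ, c = ((k + 1 : ℕ) : ℤ) := ⟨(c - 1).toNat, by omega⟩
      rw [natCast_zsmul]
      exact hsmul v hv k
    -- Fourier–Motzkin elimination of coordinate 0: `Q` is the slice of `P` where it vanishes, and
    -- `comb u v` is the positive combination of `u` and `v` in which it cancels.
    let Q : Set (Fin n → ℤ) := {u | Fin.cons 0 u ∈ P}
    let comb : (Fin (n + 1) → ℤ) → (Fin (n + 1) → ℤ) → Fin n → ℤ :=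
      fun u v k => u 0 * v k.succ - v 0 * u k.succ
    let T : Set (Fin n → ℤ) :=
      (Fin.tail '' {u ∈ S | u 0 = 0}) ∪ Set.image2 comb {u ∈ S | 0 < u 0} {v ∈ S | v 0 < 0}
    have hT : T.Finite := ((hS.subset (Set.sep_subset _ _)).image _).union
      (Set.Finite.image2 _ (hS.subset (Set.sep_subset _ _)) (hS.subset (Set.sep_subset _ _)))
    have hTQ : T ⊆ Q := by
      rintro _ (⟨u, ⟨hu, hu0⟩, rfl⟩ | ⟨u, ⟨hu, hu0⟩, v, ⟨hv, hv0⟩, rfl⟩)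
      · change Fin.cons 0 (Fin.tail u) ∈ P
        rw [← hu0, Fin.cons_self_tail]
        exact hSP hu
      · change Fin.cons 0 (comb u v) ∈ P
        have h := hadd _ (hsmulZ v (hSP hv) (u 0) hu0) _ (hsmulZ u (hSP hu) (-v 0) (by omega))
        convert h using 1
        funext k
        refine Fin.cases ?_ (fun k => ?_) k
        · simp; ring
        · simp [comb]; ring
    obtain ⟨w, hw⟩ := ih Q
      (fun u hu v hv => by
        have := hadd _ hu _ hv
        change Fin.cons 0 (u + v) ∈ P
        convert this using 1
        funext k
        refine Fin.cases ?_ (fun k => ?_) k <;> simp)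
      (fun h => h0 (by
        change Fin.cons 0 0 ∈ P at h
        convert h using 1
        funext k
        refine Fin.cases ?_ (fun k => ?_) k <;> simp)) T hT hTQ
    let φ : (Fin (n + 1) → ℤ) → ℚ := fun v => ∑ k, w k * (v k.succ : ℚ)
    have hcomb : ∀ u ∈ S, 0 < u 0 → ∀ v ∈ S, v 0 < 0 →
        (-φ u / (u 0 : ℚ)) < -φ v / (v 0 : ℚ) := by
      intro u hu hu0 v hv hv0
      have h := hw (comb u v) (Or.inr ⟨u, ⟨hu, hu0⟩, v, ⟨hv, hv0⟩, rfl⟩)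
      have e : ∑ k, w k * (comb u v k : ℚ) = u 0 * φ v - v 0 * φ u := by
        simp only [φ, comb, Finset.mul_sum, ← Finset.sum_sub_distrib]
        refine Finset.sum_congr rfl fun k _ => ?_
        push_cast
        ring
      rw [e] at h
      have hu0' : (0 : ℚ) < u 0 := by exact_mod_cast hu0
      have hv0' : (v 0 : ℚ) < 0 := by exact_mod_cast hv0
      rw [div_lt_iff₀ hu0', div_mul_eq_mul_div, lt_div_iff_of_neg hv0']
      linarith
    -- The missing weight `t` must exceed the bounds from vectors with `u 0 > 0` and stay below
    -- those from vectors with `u 0 < 0`; `hcomb` makes these compatible.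
    obtain ⟨t, ht1, ht2⟩ := Set.Finite.exists_between'
      (s := (fun u => -φ u / (u 0 : ℚ)) '' {u ∈ S | 0 < u 0})
      (t := (fun u => -φ u / (u 0 : ℚ)) '' {u ∈ S | u 0 < 0})
      ((hS.subset (Set.sep_subset _ _)).image _)
      ((hS.subset (Set.sep_subset _ _)).image _) (by
        rintro _ ⟨u, ⟨hu, hu0⟩, rfl⟩ _ ⟨v, ⟨hv, hv0⟩, rfl⟩
        exact hcomb u hu hu0 v hv hv0)
    refine ⟨Fin.cons t w, fun v hv => ?_⟩
    rw [Fin.sum_univ_succ]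
    simp only [Fin.cons_zero, Fin.cons_succ]
    change 0 < t * (v 0 : ℚ) + φ v
    rcases lt_trichotomy (v 0) 0 with h | h | h
    · have := ht2 _ ⟨v, ⟨hv, h⟩, rfl⟩
      have h' : (v 0 : ℚ) < 0 := by exact_mod_cast h
      rw [lt_div_iff_of_neg h'] at this
      linarith
    · have := hw (Fin.tail v) (Or.inl ⟨v, ⟨hv, h⟩, rfl⟩)
      simpa [h, φ, Fin.tail] using this
    · have := ht1 _ ⟨v, ⟨hv, h⟩, rfl⟩
      have h' : (0 : ℚ) < v 0 := by exact_mod_cast h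
      rw [div_lt_iff₀ h'] at this
      linarith

/-- Finitely many comparisons of a monomial order are those of a nonnegative rational weight. -/
theorem exists_weight {n : ℕ} (m : MonomialOrder (Fin n))
    (S : Set ((Fin n →₀ ℕ) × (Fin n →₀ ℕ))) (hS : S.Finite)
    (hlt : ∀ p ∈ S, m.toSyn p.1 < m.toSyn p.2) :
    ∃ w : Fin n → ℚ, 0 ≤ w ∧ ∀ p ∈ S, ∑ k, w k * (p.1 k : ℚ) < ∑ k, w k * (p.2 k : ℚ) := by
  let d : (Fin n →₀ ℕ) × (Fin n →₀ ℕ) → Fin n → ℤ := fun p k => (p.2 k : ℤ) - p.1 k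
  let P : Set (Fin n → ℤ) := d '' {p | m.toSyn p.1 < m.toSyn p.2}
  -- The pairs `(0, single k 1)` are added to `S` because every monomial order puts `1` below `X_k`;
  -- they force the weight to be nonnegative.
  obtain ⟨w, hw⟩ := exists_weight_pos P
    (by
      rintro _ ⟨p, hp, rfl⟩ _ ⟨q, hq, rfl⟩
      refine ⟨p + q, ?_, ?_⟩
      · simp only [Set.mem_ofPred_eq, Prod.fst_add, Prod.snd_add, map_add] at hp hq ⊢
        exact add_lt_add hp hq
      · funext k
        simp [d]
        ring)
    (by
      rintro ⟨p, hp, h⟩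
      have : p.1 = p.2 := by
        ext k
        have := congrFun h k
        simp only [d, Pi.zero_apply] at this
        omega
      simp [this] at hp)
    (d '' (S ∪ Set.range fun k => (0, Finsupp.single k 1)))
    ((hS.union (Set.finite_range _)).image _)
    (Set.image_mono (by
      rintro p (hp | ⟨k, rfl⟩)
      · exact hlt p hp
      · simp only [Set.mem_ofPred_eq, map_zero, MonomialOrder.toSyn_lt_iff_ne_zero, ne_eq,
          MonomialOrder.toSyn_eq_zero_iff]
        simp))
  refine ⟨w, fun k => ?_, fun p hp => ?_⟩
  · have := hw _ ⟨_, Or.inr ⟨k, rfl⟩, rfl⟩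
    simp only [d, Finsupp.single_apply] at this
    simpa using this.le
  · have := hw _ ⟨p, Or.inl hp, rfl⟩
    simp only [d, Int.cast_sub, Int.cast_natCast, mul_sub, Finset.sum_sub_distrib] at this
    linarith

/-- Dickson's lemma: every set of exponents has a finite subset below all its elements. -/
theorem exists_finite_subset_le {n : ℕ} (A : Set (Fin n →₀ ℕ)) :
    ∃ A₀ : Finset (Fin n →₀ ℕ), ↑A₀ ⊆ A ∧ ∀ a ∈ A, ∃ b ∈ A₀, b ≤ a := by
  have hfin : {a | Minimal (· ∈ A) a}.Finite :=
    WellQuasiOrderedLE.finite_of_isAntichain (setOfPred_minimal_antichain _)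
  refine ⟨hfin.toFinset, fun a ha => ?_, fun a ha => ?_⟩
  · rw [Set.Finite.coe_toFinset] at ha
    exact ha.prop
  · obtain ⟨b, hb, hb'⟩ := exists_minimal_le_of_wellFoundedLT (· ∈ A) a ha
    exact ⟨b, by simpa using hb', hb⟩

end Combinatorics

end TateGB

namespace TateGB

/-! ### Convergent series in the complete field -/

section Completeness

variable {K : Type*} [Field K] [Valued K ℤᵐ⁰]

theorem val_eq_of_v_eq {a b : K} (h : Valued.v a = Valued.v b) : val a = val b := by
  simp [val, h]

theorem nonarchimedeanAddGroup_of_valued : NonarchimedeanAddGroup K where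
  is_nonarchimedean U hU := by
    obtain ⟨γ, hγ⟩ := Valued.mem_nhds_zero.1 hU
    exact ⟨⟨Valuation.ltAddSubgroup Valued.v.restrict γ, Valued.isOpen_ball K γ.1⟩, hγ⟩

/-- A series whose terms have valuations growing at least linearly converges, with the same bound
for its tails. -/
theorem exists_series_limit [CompleteSpace K] (u : ℕ → K) (c δ : ℚ) (hδ : 0 < δ)
    (hu : ∀ k, u k ≠ 0 → c + k * δ ≤ val (u k)) :
    ∃ y : K, ∀ N : ℕ, y - ∑ k ∈ Finset.range N, u k ≠ 0 →
      c + N * δ ≤ val (y - ∑ k ∈ Finset.range N, u k) := by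
  have : NonarchimedeanAddGroup K := nonarchimedeanAddGroup_of_valued
  have hsum : Summable u := by
    apply NonarchimedeanAddGroup.summable_of_tendsto_cofinite_zero
    rw [Nat.cofinite_eq_atTop]
    intro U hU
    obtain ⟨γ, hγ⟩ := Valued.mem_nhds_zero.1 hU
    set g : ℤᵐ⁰ := MonoidWithZeroHom.ValueGroup₀.embedding γ.1 with hg
    have hg0 : g ≠ 0 := by simp [hg]
    obtain ⟨N, hN⟩ := exists_nat_gt ((-((WithZero.log g : ℤ) : ℚ) - c) / δ)
    refine Filter.mem_map.2 (Filter.mem_atTop_sets.2 ⟨N, fun k hk => hγ ?_⟩)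
    simp only [Set.mem_ofPred_eq, Valuation.restrict_lt_iff_lt_embedding]
    by_cases h0 : u k = 0
    · rw [h0, map_zero]
      exact zero_lt_iff.2 hg0
    · have h1 : Valued.v (u k) ≠ 0 := (Valuation.ne_zero_iff _).2 h0
      refine (WithZero.log_lt_log h1 hg0).1 ?_
      have h2 := hu k h0
      rw [div_lt_iff₀ hδ] at hN
      have h3 : (N : ℚ) * δ ≤ k * δ := by gcongr
      simp only [val, Int.cast_neg] at h2
      have h4 : ((WithZero.log (Valued.v (u k)) : ℤ) : ℚ) < (WithZero.log g : ℤ) := by linarith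
      exact_mod_cast h4
  refine ⟨∑' k, u k, fun N hne => ?_⟩
  set x := (∑' k, u k) - ∑ k ∈ Finset.range N, u k with hx
  have ht : Filter.Tendsto (fun M => ∑ k ∈ Finset.range M, u k - ∑ k ∈ Finset.range N, u k)
      Filter.atTop (nhds x) := (hsum.hasSum.tendsto_sum_nat).sub_const _
  -- The valuation is locally constant away from zero, so a nonzero tail has the valuation of a
  -- finite block of terms, where the ultrametric inequality applies.
  have hev : ∀ᶠ M in Filter.atTop,
      Valued.v (∑ k ∈ Finset.range M, u k - ∑ k ∈ Finset.range N, u k) = Valued.v x := ht (Valued.locally_const ((Valuation.ne_zero_iff _).2 hne))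
  obtain ⟨M, hM, hNM⟩ := (hev.and (Filter.eventually_ge_atTop N)).exists
  rw [← val_eq_of_v_eq hM]
  rw [← Finset.sum_Ico_eq_sub _ hNM] at hM ⊢
  have hne' : ∑ k ∈ Finset.Ico N M, u k ≠ 0 := by
    rw [← Valuation.ne_zero_iff Valued.v, hM]
    exact (Valuation.ne_zero_iff _).2 hne
  obtain ⟨k, hk, hk0, hle⟩ := exists_val_le _ _ hne'
  have h1 := hu k hk0
  have h2 : (N : ℚ) * δ ≤ k * δ := by
    have := (Finset.mem_Ico.1 hk).1
    gcongr
  have h3 : (val (u k) : ℚ) ≤ val (∑ q ∈ Finset.Ico N M, u q) := by exact_mod_cast hle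
  linarith

end Completeness

/-! ### Gauss valuation bounds and the contraction principle -/

section Gauss

variable {K : Type*} [Field K] [Valued K ℤᵐ⁰] {n : ℕ}

/-- All terms of `f` have Gauss valuation at least `B`. -/
def GaussGE (r : Fin n → ℚ) (B : ℚ) (f : MvPowerSeries (Fin n) K) : Prop :=
  ∀ i, MvPowerSeries.coeff i f ≠ 0 → B ≤ termVal r (MvPowerSeries.coeff i f) i

theorem termVal_neg (r : Fin n → ℚ) (a : K) (i : Fin n →₀ ℕ) :
    termVal r (-a) i = termVal r a i := by
  simp [termVal, val_neg]

theorem termVal_mul (r : Fin n → ℚ) {a b : K} (ha : a ≠ 0) (hb : b ≠ 0) (i j : Fin n →₀ ℕ) :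
    termVal r (a * b) (i + j) = termVal r a i + termVal r b j := by
  simp only [termVal, val_mul ha hb, Finsupp.add_apply, Nat.cast_add, mul_add,
    Finset.sum_add_distrib, Int.cast_add]
  ring

theorem exists_termVal_le {ι : Type*} (r : Fin n → ℚ) (i : Fin n →₀ ℕ) (s : Finset ι) (u : ι → K)
    (h : ∑ p ∈ s, u p ≠ 0) :
    ∃ p ∈ s, u p ≠ 0 ∧ termVal r (u p) i ≤ termVal r (∑ q ∈ s, u q) i := by
  obtain ⟨p, hp, h0, hle⟩ := exists_val_le s u h
  refine ⟨p, hp, h0, ?_⟩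
  simp only [termVal]
  gcongr

theorem le_termVal_add {r : Fin n → ℚ} {i : Fin n →₀ ℕ} {a b : K} {B : ℚ}
    (ha : a ≠ 0 → B ≤ termVal r a i) (hb : b ≠ 0 → B ≤ termVal r b i) (h : a + b ≠ 0) :
    B ≤ termVal r (a + b) i := by
  have e : a + b = ∑ c : Bool, (if c then a else b) := by simp
  rw [e] at h ⊢
  obtain ⟨c, -, hc, hle⟩ := exists_termVal_le r i _ _ h
  refine le_trans ?_ hle
  cases c
  · exact hb hc
  · exact ha hc

theorem GaussGE.mono {r : Fin n → ℚ} {B C : ℚ} {f : MvPowerSeries (Fin n) K} (hf : GaussGE r B f)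
    (h : C ≤ B) : GaussGE r C f :=
  fun i hi => h.trans (hf i hi)

theorem gaussGE_zero (r : Fin n → ℚ) (B : ℚ) : GaussGE r B (0 : MvPowerSeries (Fin n) K) :=
  fun _ hi => absurd (map_zero _) hi

theorem GaussGE.add {r : Fin n → ℚ} {B : ℚ} {f g : MvPowerSeries (Fin n) K} (hf : GaussGE r B f)
    (hg : GaussGE r B g) : GaussGE r B (f + g) := by
  intro i hi
  rw [map_add] at hi ⊢
  exact le_termVal_add (hf i) (hg i) hi

theorem GaussGE.neg {r : Fin n → ℚ} {B : ℚ} {f : MvPowerSeries (Fin n) K} (hf : GaussGE r B f) :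
    GaussGE r B (-f) := by
  intro i hi
  rw [map_neg] at hi ⊢
  rw [termVal_neg]
  exact hf i (neg_ne_zero.1 hi)

theorem GaussGE.sub {r : Fin n → ℚ} {B : ℚ} {f g : MvPowerSeries (Fin n) K} (hf : GaussGE r B f)
    (hg : GaussGE r B g) : GaussGE r B (f - g) :=
  sub_eq_add_neg f g ▸ hf.add hg.neg

theorem GaussGE.mul {r : Fin n → ℚ} {B C : ℚ} {f g : MvPowerSeries (Fin n) K}
    (hf : GaussGE r B f) (hg : GaussGE r C g) : GaussGE r (B + C) (f * g) := by
  intro k hk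
  rw [MvPowerSeries.coeff_mul] at hk ⊢
  obtain ⟨⟨i, j⟩, hp, hne, hle⟩ := exists_termVal_le r k _ _ hk
  obtain ⟨hi, hj⟩ := mul_ne_zero_iff.1 hne
  rw [Finset.HasAntidiagonal.mem_antidiagonal] at hp
  refine le_trans ?_ hle
  subst hp
  rw [termVal_mul r hi hj]
  exact add_le_add (hf i hi) (hg j hj)

theorem GaussGE.sum {ι : Type*} {r : Fin n → ℚ} {B : ℚ} {s : Finset ι}
    {f : ι → MvPowerSeries (Fin n) K} (hf : ∀ p ∈ s, GaussGE r B (f p)) :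
    GaussGE r B (∑ p ∈ s, f p) :=
  Finset.sum_induction _ _ (fun _ _ => GaussGE.add) (gaussGE_zero r B) hf

theorem Converges.gaussGE {r : Fin n → ℚ} {f : MvPowerSeries (Fin n) K} (hf : Converges r f) :
    ∃ L, GaussGE r L f :=
  hf.bddBelow

theorem eq_zero_of_forall_gaussGE {r : Fin n → ℚ} {f : MvPowerSeries (Fin n) K}
    (h : ∀ B, GaussGE r B f) : f = 0 := by
  ext i
  by_contra hi
  have := h (termVal r (MvPowerSeries.coeff i f) i + 1) i hi
  linarith

theorem Converges.sum {ι : Type*} {r : Fin n → ℚ} {s : Finset ι}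
    {f : ι → MvPowerSeries (Fin n) K} (hf : ∀ p ∈ s, Converges r (f p)) :
    Converges r (∑ p ∈ s, f p) :=
  (tateAlgebra K r).sum_mem hf

theorem converges_of_forall_approx {r : Fin n → ℚ} {f : MvPowerSeries (Fin n) K}
    (h : ∀ B, ∃ g, Converges r g ∧ GaussGE r B (f - g)) : Converges r f := by
  intro B
  obtain ⟨g, hg, hfg⟩ := h (B + 1)
  refine (hg B).subset ?_
  rintro i ⟨hi, hB⟩
  by_contra hc
  have h2 := le_termVal_add (B := min (B + 1) (termVal r (MvPowerSeries.coeff i g) i))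
    (r := r) (i := i)
    (a := MvPowerSeries.coeff i (f - g)) (b := MvPowerSeries.coeff i g)
    (fun h => (min_le_left _ _).trans (hfg i h)) (fun _ => min_le_right _ _) (by simpa using hi)
  rw [← map_add, sub_add_cancel] at h2
  by_cases h0 : MvPowerSeries.coeff i g = 0
  · have := hfg i (by simpa [h0] using hi)
    rw [map_sub, h0, sub_zero] at this
    linarith
  · have h3 : B < termVal r (MvPowerSeries.coeff i g) i := by
      by_contra h4
      exact hc ⟨h0, not_lt.1 h4⟩
    have := lt_min (lt_add_one B) h3
    linarith

/-- A map raising Gauss valuations by a fixed positive amount has `1 - T` surjective, with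
solutions of `h - T h = f` close to `f`. -/
theorem exists_eq_add_contraction [CompleteSpace K] {r : Fin n → ℚ}
    (T : MvPowerSeries (Fin n) K →+ MvPowerSeries (Fin n) K)
    {δ : ℚ} (hδ : 0 < δ) (hT : ∀ B f, GaussGE r B f → GaussGE r (B + δ) (T f))
    (hTc : ∀ f, Converges r f → Converges r (T f)) (f : MvPowerSeries (Fin n) K)
    (hf : Converges r f) :
    ∃ h, Converges r h ∧ h = f + T h ∧ ∀ B, GaussGE r B f → GaussGE r (B + δ) (T h) := by
  obtain ⟨L, hL⟩ := hf.gaussGE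
  -- Neumann series: `h` is the sum of the iterates of `T` on `f`, taken coefficientwise in `K`.
  set u : ℕ → MvPowerSeries (Fin n) K := fun k => T^[k] f with hu
  have hsucc : ∀ k, u (k + 1) = T (u k) := fun k => Function.iterate_succ_apply' T k f
  have hc : ∀ k, Converges r (u k) := by
    intro k
    induction k with
    | zero => exact hf
    | succ k ih => rw [hsucc]; exact hTc _ ih
  have hge : ∀ B, GaussGE r B f → ∀ k : ℕ, GaussGE r (B + k * δ) (u k) := by
    intro B hB k
    induction k with
    | zero => simpa [hu] using hB
    | succ k ih =>
      rw [hsucc]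
      exact (hT _ _ ih).mono (by push_cast; linarith)
  have hlim : ∀ i, ∃ y : K, ∀ N : ℕ,
      y - ∑ k ∈ Finset.range N, MvPowerSeries.coeff i (u k) ≠ 0 →
      (L + ∑ k, r k * (i k : ℚ)) + N * δ ≤
        val (y - ∑ k ∈ Finset.range N, MvPowerSeries.coeff i (u k)) := by
    intro i
    refine exists_series_limit _ _ δ hδ fun k hk => ?_
    have := hge L hL k i hk
    simp only [termVal] at this
    linarith
  choose y hy using hlim
  let h : MvPowerSeries (Fin n) K := fun i => y i
  have hcoeff : ∀ i, MvPowerSeries.coeff i h = y i := fun i => rfl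
  have htail : ∀ N : ℕ, GaussGE r (L + N * δ) (h - ∑ k ∈ Finset.range N, u k) := by
    intro N i hi
    rw [map_sub, map_sum, hcoeff] at hi ⊢
    have := hy i N hi
    simp only [termVal]
    linarith
  have hS : ∀ N, f + T (∑ k ∈ Finset.range N, u k) = ∑ k ∈ Finset.range (N + 1), u k := by
    intro N
    rw [Finset.sum_range_succ', map_sum, add_comm]
    simp only [hsucc]
    rfl
  have harch : ∀ M B : ℚ, ∃ N : ℕ, B ≤ M + N * δ := by
    intro M B
    obtain ⟨N, hN⟩ := exists_nat_ge ((B - M) / δ)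
    rw [div_le_iff₀ hδ] at hN
    exact ⟨N, by linarith⟩
  have hconv : Converges r h := by
    refine converges_of_forall_approx fun B => ?_
    obtain ⟨N, hN⟩ := harch L B
    exact ⟨_, Converges.sum fun k _ => hc k, (htail N).mono hN⟩
  have hfix : h = f + T h := by
    rw [← sub_eq_zero]
    refine eq_zero_of_forall_gaussGE (r := r) fun B => ?_
    obtain ⟨N, hN⟩ := harch L B
    have e : h - (f + T h) = (h - ∑ k ∈ Finset.range (N + 1), u k) -
        T (h - ∑ k ∈ Finset.range N, u k) := by
      rw [← hS, map_sub]
      abel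
    rw [e]
    refine ((htail (N + 1)).mono ?_).sub ((hT _ _ (htail N)).mono ?_)
    · push_cast; linarith
    · linarith
  refine ⟨h, hconv, hfix, fun B hB => hT _ _ ?_⟩
  obtain ⟨N, hN⟩ := harch L B
  rw [← sub_add_cancel h (∑ k ∈ Finset.range N, u k)]
  refine ((htail N).mono hN).add (GaussGE.sum fun k _ => (hge B hB k).mono ?_)
  have : 0 ≤ (k : ℚ) * δ := by positivity
  linarith

end Gauss

end TateGB

namespace TateGB

/-! ### Absorbing tie-breaks, and stability of leading exponents -/

section StrictLead

variable {K : Type*} [Field K] [Valued K ℤᵐ⁰] {n : ℕ}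

/-- `i` is the exponent of the only term of `f` of minimal Gauss valuation. -/
def StrictLead (s : Fin n → ℚ) (f : MvPowerSeries (Fin n) K) (i : Fin n →₀ ℕ) : Prop :=
  MvPowerSeries.coeff i f ≠ 0 ∧ ∀ j, j ≠ i → MvPowerSeries.coeff j f ≠ 0 →
    termVal s (MvPowerSeries.coeff i f) i < termVal s (MvPowerSeries.coeff j f) j

theorem StrictLead.isLeadingExponent {s : Fin n → ℚ} {f : MvPowerSeries (Fin n) K}
    {i : Fin n →₀ ℕ} (h : StrictLead s f i) (m : MonomialOrder (Fin n)) :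
    IsLeadingExponent s m f i :=
  ⟨h.1, fun j hj hj0 => Or.inl (h.2 j hj hj0)⟩

theorem IsLeadingExponent.termVal_le {s : Fin n → ℚ} {m : MonomialOrder (Fin n)}
    {f : MvPowerSeries (Fin n) K} {i : Fin n →₀ ℕ} (h : IsLeadingExponent s m f i)
    (j : Fin n →₀ ℕ) (hj : MvPowerSeries.coeff j f ≠ 0) :
    termVal s (MvPowerSeries.coeff i f) i ≤ termVal s (MvPowerSeries.coeff j f) j := by
  by_cases hji : j = i
  · rw [hji]
  · rcases h.2 j hji hj with h | h
    · exact h.le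
    · exact h.1.ge

theorem leadingTerm_eq {r : Fin n → ℚ} {m : MonomialOrder (Fin n)}
    {f : MvPowerSeries (Fin n) K} {i : Fin n →₀ ℕ} (h : IsLeadingExponent r m f i) :
    leadingTerm r m f = MvPolynomial.monomial i (MvPowerSeries.coeff i f) := by
  have hex : ∃ i, IsLeadingExponent r m f i := ⟨i, h⟩
  rw [leadingTerm, dif_pos hex, hex.choose_spec.unique h]

theorem leadingTerm_zero (r : Fin n → ℚ) (m : MonomialOrder (Fin n)) :
    leadingTerm r m (0 : MvPowerSeries (Fin n) K) = 0 := by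
  rw [leadingTerm, dif_neg]
  rintro ⟨i, hi, -⟩
  exact hi (map_zero _)

theorem leadingTerm_dvd_iff {r : Fin n → ℚ} {m m' : MonomialOrder (Fin n)}
    {f g : MvPowerSeries (Fin n) K} {i j : Fin n →₀ ℕ} (hf : IsLeadingExponent r m f i)
    (hg : IsLeadingExponent r m' g j) : leadingTerm r m f ∣ leadingTerm r m' g ↔ i ≤ j := by
  rw [leadingTerm_eq hf, leadingTerm_eq hg, MvPolynomial.monomial_dvd_monomial]
  have h : MvPowerSeries.coeff i f ∣ MvPowerSeries.coeff j g := (IsUnit.mk0 _ hf.1).dvd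
  simp only [hg.1, h, false_or, and_true]

theorem exists_leadingExponent_le {r : Fin n → ℚ} {m : MonomialOrder (Fin n)}
    {f g : MvPowerSeries (Fin n) K} {j : Fin n →₀ ℕ} (hf : Converges r f)
    (hg : IsLeadingExponent r m g j) (h : leadingTerm r m f ∣ leadingTerm r m g) :
    ∃ i, IsLeadingExponent r m f i ∧ i ≤ j := by
  have hf0 : f ≠ 0 := by
    rintro rfl
    rw [leadingTerm_zero, zero_dvd_iff, leadingTerm_eq hg, MvPolynomial.monomial_eq_zero] at h
    exact hg.1 h
  obtain ⟨i, hi⟩ := exists_isLeadingExponent r m hf hf0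
  exact ⟨i, hi, (leadingTerm_dvd_iff hi hg).1 h⟩

theorem termVal_add_smul (r w : Fin n → ℚ) (ε : ℚ) (a : K) (i : Fin n →₀ ℕ) :
    termVal (r + ε • w) a i = termVal r a i - ε * ∑ k, w k * (i k : ℚ) := by
  simp only [termVal, Pi.add_apply, Pi.smul_apply, smul_eq_mul, add_mul, Finset.sum_add_distrib,
    Finset.mul_sum, mul_assoc]
  ring

theorem termVal_anti {r s : Fin n → ℚ} (h : r ≤ s) (a : K) (i : Fin n →₀ ℕ) :
    termVal s a i ≤ termVal r a i := by
  simp only [termVal]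
  gcongr with k
  exact h k

theorem Converges.anti {r s : Fin n → ℚ} (h : r ≤ s) {f : MvPowerSeries (Fin n) K}
    (hf : Converges s f) : Converges r f :=
  fun B => (hf B).subset fun i hi => ⟨hi.1, (termVal_anti h _ i).trans hi.2⟩

/-- For finitely many polynomials, the tie-break order can be absorbed in a small increase of the
log-radii. -/
theorem exists_strictLead (r : Fin n → ℚ) (m : MonomialOrder (Fin n))
    (F : Set (MvPolynomial (Fin n) K)) (hF : F.Finite) :
    ∃ s : Fin n → ℚ, r ≤ s ∧ ∀ p ∈ F, ∀ i,
      IsLeadingExponent r m (p : MvPowerSeries (Fin n) K) i →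
      StrictLead s (p : MvPowerSeries (Fin n) K) i := by
  let U : Set (Fin n →₀ ℕ) := ⋃ p ∈ F, (p.support : Set (Fin n →₀ ℕ))
  have hU : U.Finite := hF.biUnion fun p _ => p.support.finite_toSet
  obtain ⟨w, hw0, hw⟩ := exists_weight m {p ∈ U ×ˢ U | m.toSyn p.1 < m.toSyn p.2}
    ((hU.prod hU).subset (Set.sep_subset _ _)) fun p hp => hp.2
  have hev : ∀ᶠ ε in nhdsWithin (0 : ℚ) (Set.Ioi 0), ∀ p ∈ F, ∀ i ∈ U, ∀ j ∈ U,
      termVal r (p.coeff i) i < termVal r (p.coeff j) j →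
      termVal (r + ε • w) (p.coeff i) i < termVal (r + ε • w) (p.coeff j) j := by
    rw [Filter.eventually_all_finite hF]
    intro p _
    rw [Filter.eventually_all_finite hU]
    intro i _
    rw [Filter.eventually_all_finite hU]
    intro j _
    by_cases hlt : termVal r (p.coeff i) i < termVal r (p.coeff j) j
    · simp only [termVal_add_smul]
      have hc : Continuous fun ε : ℚ => (termVal r (p.coeff j) j - ε * ∑ k, w k * (j k : ℚ)) -
          (termVal r (p.coeff i) i - ε * ∑ k, w k * (i k : ℚ)) := by fun_prop
      have := (hc.tendsto 0).eventually (lt_mem_nhds (a := 0) (by simpa using hlt))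
      filter_upwards [nhdsWithin_le_nhds this] with ε hε _
      exact sub_pos.1 hε
    · exact Filter.Eventually.of_forall fun _ h => absurd h hlt
  obtain ⟨ε, hε, hε0⟩ := (hev.and self_mem_nhdsWithin).exists
  have hε0 : 0 < ε := hε0
  refine ⟨r + ε • w, le_add_of_nonneg_right (smul_nonneg hε0.le hw0), fun p hp i hi => ?_⟩
  have hmem : ∀ j, MvPowerSeries.coeff j (p : MvPowerSeries (Fin n) K) ≠ 0 → j ∈ U := by
    intro j hj
    rw [MvPolynomial.coeff_coe] at hj
    exact Set.mem_biUnion hp (by simpa using hj)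
  refine ⟨hi.1, fun j hji hj => ?_⟩
  have hiU := hmem i hi.1
  have hjU := hmem j hj
  have hlt := hi.2 j hji hj
  simp only [MvPolynomial.coeff_coe] at hlt ⊢
  rcases hlt with h | ⟨h, h'⟩
  · exact hε p hp i hiU j hjU h
  -- On a tie at `r`, the exponent larger for `m` has larger `w`-weight, and raising the log-radii
  -- lowers its valuation more.
  · rw [termVal_add_smul, termVal_add_smul, h]
    have := hw (j, i) ⟨⟨hjU, hiU⟩, h'⟩
    have := mul_lt_mul_of_pos_left this hε0
    linarith

theorem termVal_eq_of_sub {r : Fin n → ℚ} {a b : K} {i : Fin n →₀ ℕ} (ha : a ≠ 0)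
    (h : a - b ≠ 0 → termVal r a i < termVal r (a - b) i) :
    b ≠ 0 ∧ termVal r b i = termVal r a i := by
  have hv : Valued.v (b - a) < Valued.v a := by
    by_cases h0 : a - b = 0
    · rw [← neg_sub, h0, neg_zero, map_zero]
      exact zero_lt_iff.2 ((Valuation.ne_zero_iff _).2 ha)
    · rw [Valuation.map_sub_swap]
      by_contra! hle
      have h1 := h h0
      have h2 := val_le_val ha hle
      have h3 : (val (a - b) : ℚ) ≤ val a := by exact_mod_cast h2
      simp only [termVal] at h1
      linarith
  have hv' := Valuation.map_eq_of_sub_lt _ hv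
  refine ⟨?_, by simp only [termVal, val_eq_of_v_eq hv']⟩
  rw [← Valuation.ne_zero_iff Valued.v, hv']
  exact (Valuation.ne_zero_iff _).2 ha

/-- An error of valuation above the leading one changes no valuation at or below that level, by the
ultrametric equality case. The margin `1` could be any positive number. -/
theorem IsLeadingExponent.of_approx {r : Fin n → ℚ} {m : MonomialOrder (Fin n)}
    {f g : MvPowerSeries (Fin n) K} {i : Fin n →₀ ℕ} (hf : IsLeadingExponent r m f i)
    (hfg : GaussGE r (termVal r (MvPowerSeries.coeff i f) i + 1) (f - g)) :
    IsLeadingExponent r m g i := by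
  obtain ⟨h0, h1⟩ := termVal_eq_of_sub (b := MvPowerSeries.coeff i g) hf.1 fun h =>
    (lt_add_one _).trans_le (by simpa using hfg i (by simpa using h))
  refine ⟨h0, fun j hji hj => ?_⟩
  rw [TermLT, h1]
  by_cases hlt : termVal r (MvPowerSeries.coeff i f) i < termVal r (MvPowerSeries.coeff j g) j
  · exact Or.inl hlt
  · obtain ⟨h2, h3⟩ := termVal_eq_of_sub (a := MvPowerSeries.coeff j g)
      (b := MvPowerSeries.coeff j f) (r := r) (i := j) hj fun h => by
        have := hfg.neg j (by simpa using h)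
        simp only [neg_sub, map_sub] at this
        linarith
    rw [← h3]
    exact hf.2 j hji h2

theorem IsLeadingExponent.monomial_mul {r : Fin n → ℚ} {m : MonomialOrder (Fin n)}
    {f : MvPowerSeries (Fin n) K} {i : Fin n →₀ ℕ} (hf : IsLeadingExponent r m f i)
    (b : Fin n →₀ ℕ) {c : K} (hc : c ≠ 0) :
    IsLeadingExponent r m (MvPowerSeries.monomial b c * f) (b + i) := by
  have hco : ∀ i, MvPowerSeries.coeff (b + i) (MvPowerSeries.monomial b c * f) =
      c * MvPowerSeries.coeff i f := fun i => by
    simp [MvPowerSeries.coeff_monomial_mul]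
  refine ⟨by rw [hco]; exact mul_ne_zero hc hf.1, fun j hj hj0 => ?_⟩
  have hbj : b ≤ j := by
    by_contra h
    simp [MvPowerSeries.coeff_monomial_mul, h] at hj0
  obtain ⟨j, rfl⟩ := exists_add_of_le hbj
  rw [hco] at hj0
  have hj1 := right_ne_zero_of_mul hj0
  rw [TermLT, hco, hco, termVal_mul r hc hf.1, termVal_mul r hc hj1, map_add, map_add]
  rcases hf.2 j (by rintro rfl; exact hj rfl) hj1 with h | h
  · exact Or.inl (by linarith)
  · exact Or.inr ⟨by linarith [h.1], by gcongr; exact h.2⟩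

end StrictLead

/-! ### Density of `I` in `I_r`, and restriction between radii -/

section Ideals

variable {K : Type*} [Field K] [Valued K ℤᵐ⁰] {n : ℕ}

@[simp]
theorem coe_polyToTate (r : Fin n → ℚ) (p : MvPolynomial (Fin n) K) :
    (polyToTate r p : MvPowerSeries (Fin n) K) = p :=
  rfl

/-- Truncation: a convergent series is a polynomial up to terms of large Gauss valuation. -/
theorem Converges.exists_polynomial {r : Fin n → ℚ} {f : MvPowerSeries (Fin n) K}
    (hf : Converges r f) (B : ℚ) :
    ∃ p : MvPolynomial (Fin n) K, GaussGE r B (f - (p : MvPowerSeries (Fin n) K)) := by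
  classical
  refine ⟨∑ i ∈ (hf B).toFinset, MvPolynomial.monomial i (MvPowerSeries.coeff i f), ?_⟩
  intro i hi
  simp only [map_sub, MvPolynomial.coeff_coe, MvPolynomial.coeff_sum,
    MvPolynomial.coeff_monomial, Finset.sum_ite_eq', Set.Finite.mem_toFinset,
    Set.mem_ofPred_eq] at hi ⊢
  split_ifs at hi ⊢ with h
  · simp at hi
  · rw [sub_zero] at hi ⊢
    by_contra hB
    exact h ⟨hi, (not_le.1 hB).le⟩

/-- `I` is dense in `I_r`. -/
theorem exists_approx_mem {r : Fin n → ℚ} {I : Ideal (MvPolynomial (Fin n) K)}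
    {f : tateAlgebra K r} (hf : f ∈ completedIdeal r I) (B : ℚ) :
    ∃ p ∈ I, GaussGE r B ((f : MvPowerSeries (Fin n) K) - (p : MvPowerSeries (Fin n) K)) := by
  revert B
  refine Submodule.span_induction (R := tateAlgebra K r) (M := tateAlgebra K r)
    (s := polyToTate r '' I) (p := fun (f : tateAlgebra K r) _ => ∀ B, ∃ p ∈ I,
    GaussGE r B ((f : MvPowerSeries (Fin n) K) - (p : MvPowerSeries (Fin n) K))) ?_ ?_ ?_ ?_ hf
  · rintro _ ⟨p, hp, rfl⟩ B
    refine ⟨p, hp, ?_⟩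
    simpa using gaussGE_zero r B
  · intro B
    refine ⟨0, I.zero_mem, ?_⟩
    simpa using gaussGE_zero r B
  · intro x y _ _ hx hy B
    obtain ⟨p, hp, hxp⟩ := hx B
    obtain ⟨q, hq, hyq⟩ := hy B
    refine ⟨p + q, I.add_mem hp hq, ?_⟩
    have := hxp.add hyq
    rwa [sub_add_sub_comm, ← MvPolynomial.coe_add] at this
  · intro a x _ hx B
    obtain ⟨L, hL⟩ := Converges.gaussGE a.2
    obtain ⟨p, hp, hxp⟩ := hx (B - L)
    obtain ⟨M, hM⟩ := (converges_coe r p).gaussGE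
    obtain ⟨b, hb⟩ := Converges.exists_polynomial a.2 (B - M)
    refine ⟨b * p, I.mul_mem_left b hp, ?_⟩
    -- `a x - b p = a (x - p) + (a - b) p`, which explains the targets `B - L` and `B - M`.
    have h1 := (hL.mul hxp).add (((hb.mul hM).mono (by linarith : L + (B - L) ≤ B - M + M)))
    refine GaussGE.mono (B := L + (B - L)) ?_ (by linarith)
    convert h1 using 1
    rw [smul_eq_mul, Subring.coe_mul, MvPolynomial.coe_mul]
    ring

/-- By density and stability under approximation, completing `I` creates no new leading exponents.
-/
theorem exists_mem_isLeadingExponent {r : Fin n → ℚ} {m : MonomialOrder (Fin n)}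
    {I : Ideal (MvPolynomial (Fin n) K)} {f : tateAlgebra K r} (hf : f ∈ completedIdeal r I)
    {i : Fin n →₀ ℕ} (hi : IsLeadingExponent r m (f : MvPowerSeries (Fin n) K) i) :
    ∃ p ∈ I, IsLeadingExponent r m (p : MvPowerSeries (Fin n) K) i := by
  obtain ⟨p, hp, h⟩ := exists_approx_mem hf (termVal r (MvPowerSeries.coeff i f.1) i + 1)
  exact ⟨p, hp, hi.of_approx h⟩

/-- The restriction `K{X; s} → K{X; r}` for `r ≤ s`. -/
noncomputable def restrictTate {r s : Fin n → ℚ} (h : r ≤ s) :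
    tateAlgebra K s →+* tateAlgebra K r :=
  Subring.inclusion fun _ hf => Converges.anti h hf

theorem restrictTate_mem {r s : Fin n → ℚ} (h : r ≤ s) {I : Ideal (MvPolynomial (Fin n) K)}
    {f : tateAlgebra K s} (hf : f ∈ completedIdeal s I) :
    restrictTate h f ∈ completedIdeal r I := by
  have := Ideal.mem_map_of_mem (restrictTate h) hf
  rwa [completedIdeal, Ideal.map_map] at this

theorem polyToTate_mem (r : Fin n → ℚ) {I : Ideal (MvPolynomial (Fin n) K)}
    {p : MvPolynomial (Fin n) K} (hp : p ∈ I) : polyToTate r p ∈ completedIdeal r I :=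
  Ideal.mem_map_of_mem _ hp

end Ideals

end TateGB

namespace TateGB

/-! ### Formal division by monomials -/

section FormalDivision

variable {K : Type*} [Field K] {n : ℕ}

/-- `f` without its term of exponent `a`. -/
noncomputable def tail (a : Fin n →₀ ℕ) (f : MvPowerSeries (Fin n) K) : MvPowerSeries (Fin n) K :=
  f - MvPowerSeries.monomial a (MvPowerSeries.coeff a f)

theorem coeff_tail (a i : Fin n →₀ ℕ) (f : MvPowerSeries (Fin n) K) :
    MvPowerSeries.coeff i (tail a f) = if i = a then 0 else MvPowerSeries.coeff i f := by
  classical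
  rw [tail, map_sub, MvPowerSeries.coeff_monomial]
  split_ifs with h
  · rw [h, sub_self]
  · rw [sub_zero]

open Classical in
/-- The part of the formal quotient of `h` by `c X^a` coming from the exponents `i` with
`σ i = a`. -/
noncomputable def partialQuotient (σ : (Fin n →₀ ℕ) → Fin n →₀ ℕ) (a : Fin n →₀ ℕ) (c : K) :
    MvPowerSeries (Fin n) K →+ MvPowerSeries (Fin n) K where
  toFun h := fun j => if σ (j + a) = a then MvPowerSeries.coeff (j + a) h / c else 0
  map_zero' := by
    funext j
    simp only [map_zero, zero_div, ite_self]
    rfl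
  map_add' f g := by
    funext j
    change _ = (if σ (j + a) = a then MvPowerSeries.coeff (j + a) f / c else 0) +
      (if σ (j + a) = a then MvPowerSeries.coeff (j + a) g / c else 0)
    simp only [map_add]
    split_ifs
    · exact add_div _ _ _
    · exact (add_zero 0).symm

open Classical in
theorem coeff_partialQuotient (σ : (Fin n →₀ ℕ) → Fin n →₀ ℕ) (a : Fin n →₀ ℕ) (c : K)
    (h : MvPowerSeries (Fin n) K) (j : Fin n →₀ ℕ) :
    MvPowerSeries.coeff j (partialQuotient σ a c h) =
      if σ (j + a) = a then MvPowerSeries.coeff (j + a) h / c else 0 :=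
  rfl

open Classical in
/-- The terms of `h` whose exponents are not above any element of `A`. -/
def reducedPart (A : Finset (Fin n →₀ ℕ)) (h : MvPowerSeries (Fin n) K) :
    MvPowerSeries (Fin n) K :=
  fun i => if ∃ a ∈ A, a ≤ i then 0 else MvPowerSeries.coeff i h

open Classical in
theorem coeff_reducedPart (A : Finset (Fin n →₀ ℕ)) (h : MvPowerSeries (Fin n) K)
    (i : Fin n →₀ ℕ) : MvPowerSeries.coeff i (reducedPart A h) =
      if ∃ a ∈ A, a ≤ i then 0 else MvPowerSeries.coeff i h :=
  rfl

/-- `σ` assigns each exponent above `A` to exactly one divisor, so every term of `h` is counted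
once. -/
theorem reducedPart_add_sum (A : Finset (Fin n →₀ ℕ)) (σ : (Fin n →₀ ℕ) → Fin n →₀ ℕ)
    (hσ : ∀ i, (∃ a ∈ A, a ≤ i) → σ i ∈ A ∧ σ i ≤ i) (c : (Fin n →₀ ℕ) → K)
    (hc : ∀ a ∈ A, c a ≠ 0) (h : MvPowerSeries (Fin n) K) :
    reducedPart A h + ∑ a ∈ A, partialQuotient σ a (c a) h * MvPowerSeries.monomial a (c a) = h := by
  classical
  ext i
  rw [map_add, map_sum, coeff_reducedPart]
  have hterm : ∀ a ∈ A, MvPowerSeries.coeff i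
      (partialQuotient σ a (c a) h * MvPowerSeries.monomial a (c a)) =
      if a = σ i then (if a ≤ i then MvPowerSeries.coeff i h else 0) else 0 := by
    intro a ha
    rw [MvPowerSeries.coeff_mul_monomial]
    by_cases hai : a ≤ i
    · rw [if_pos hai, coeff_partialQuotient, tsub_add_cancel_of_le hai, if_pos hai]
      by_cases h1 : σ i = a
      · rw [if_pos h1, if_pos h1.symm, div_mul_cancel₀ _ (hc a ha)]
      · rw [if_neg h1, if_neg (Ne.symm h1), zero_mul]
    · simp [hai]
  rw [Finset.sum_congr rfl hterm, Finset.sum_ite_eq']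
  by_cases hE : ∃ a ∈ A, a ≤ i
  · obtain ⟨h1, h2⟩ := hσ i hE
    rw [if_pos hE, if_pos h1, if_pos h2, zero_add]
  · rw [if_neg hE]
    split_ifs with h1 h2
    · exact absurd ⟨_, h1, h2⟩ hE
    · exact add_zero _
    · exact add_zero _

end FormalDivision

/-! ### Division in the Tate algebra -/

section Division

variable {K : Type*} [Field K] [Valued K ℤᵐ⁰] {n : ℕ}

theorem Converges.tail {r : Fin n → ℚ} {f : MvPowerSeries (Fin n) K} (hf : Converges r f)
    (a : Fin n →₀ ℕ) : Converges r (tail a f) := by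
  refine fun B => (hf B).subset fun i hi => ?_
  simp only [Set.mem_ofPred_eq, coeff_tail] at hi
  split_ifs at hi with h
  · exact absurd rfl hi.1
  · exact hi

/-- Only finitely many tail terms have valuation at most `t + 1`, so the strict inequalities are
uniform; the remaining terms have gap at least `1`. -/
theorem StrictLead.exists_gap {s : Fin n → ℚ} {f : MvPowerSeries (Fin n) K} {a : Fin n →₀ ℕ}
    (h : StrictLead s f a) (hf : Converges s f) :
    ∃ δ > 0, GaussGE s (termVal s (MvPowerSeries.coeff a f) a + δ) (tail a f) := by
  set t := termVal s (MvPowerSeries.coeff a f) a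
  obtain ⟨b, hb1, hb2⟩ := Set.Finite.exists_between' (Set.finite_singleton t)
    ((hf.tail a (t + 1)).image fun i => termVal s (MvPowerSeries.coeff i (TateGB.tail a f)) i) (by
      rintro _ rfl _ ⟨i, ⟨hi, -⟩, rfl⟩
      simp only [coeff_tail] at hi ⊢
      split_ifs at hi ⊢ with hia
      · exact absurd rfl hi
      · exact h.2 i hia hi)
  have hb1 := hb1 t rfl
  refine ⟨min (b - t) 1, lt_min (sub_pos.2 hb1) one_pos, fun i hi => ?_⟩
  by_cases hle : termVal s (MvPowerSeries.coeff i (TateGB.tail a f)) i ≤ t + 1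
  · have := hb2 _ ⟨i, ⟨hi, hle⟩, rfl⟩
    have := min_le_left (b - t) 1
    linarith
  · have := min_le_right (b - t) 1
    linarith

theorem partialQuotient_term {r : Fin n → ℚ} (σ : (Fin n →₀ ℕ) → Fin n →₀ ℕ) {a : Fin n →₀ ℕ}
    {c : K} (hc : c ≠ 0) {h : MvPowerSeries (Fin n) K} {j : Fin n →₀ ℕ}
    (hj : MvPowerSeries.coeff j (partialQuotient σ a c h) ≠ 0) :
    MvPowerSeries.coeff (j + a) h ≠ 0 ∧ termVal r (MvPowerSeries.coeff (j + a) h) (j + a) =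
      termVal r (MvPowerSeries.coeff j (partialQuotient σ a c h)) j + termVal r c a := by
  rw [← termVal_mul r hj hc]
  rw [coeff_partialQuotient] at hj ⊢
  split_ifs at hj ⊢ with hσ
  · rw [div_mul_cancel₀ _ hc]
    exact ⟨fun h0 => hj (by rw [h0, zero_div]), rfl⟩
  · exact absurd rfl hj

theorem GaussGE.partialQuotient {r : Fin n → ℚ} {B : ℚ} {h : MvPowerSeries (Fin n) K}
    (hB : GaussGE r B h) (σ : (Fin n →₀ ℕ) → Fin n →₀ ℕ) (a : Fin n →₀ ℕ) {c : K} (hc : c ≠ 0) :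
    GaussGE r (B - termVal r c a) (partialQuotient σ a c h) := by
  intro j hj
  obtain ⟨h0, h1⟩ := partialQuotient_term (r := r) σ hc hj
  have := hB _ h0
  linarith

theorem Converges.partialQuotient {r : Fin n → ℚ} {h : MvPowerSeries (Fin n) K}
    (hh : Converges r h) (σ : (Fin n →₀ ℕ) → Fin n →₀ ℕ) (a : Fin n →₀ ℕ) {c : K} (hc : c ≠ 0) :
    Converges r (partialQuotient σ a c h) := by
  refine fun B => ((hh (B + termVal r c a)).preimage
    (f := fun j => j + a) (add_left_injective a).injOn).subset ?_
  rintro j ⟨hj, hB⟩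
  obtain ⟨h0, h1⟩ := partialQuotient_term (r := r) σ hc hj
  exact ⟨h0, by linarith⟩

theorem Converges.reducedPart {r : Fin n → ℚ} {h : MvPowerSeries (Fin n) K}
    (hh : Converges r h) (A : Finset (Fin n →₀ ℕ)) : Converges r (reducedPart A h) := by
  refine fun B => (hh B).subset fun i hi => ?_
  simp only [Set.mem_ofPred_eq, coeff_reducedPart] at hi
  split_ifs at hi with h
  · exact absurd rfl hi.1
  · exact hi

/-- Division with remainder in `K{X; s}` by finitely many series each of which has a single term
of minimal Gauss valuation. -/
theorem exists_division [CompleteSpace K] {s : Fin n → ℚ} (A : Finset (Fin n →₀ ℕ))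
    (p : (Fin n →₀ ℕ) → MvPowerSeries (Fin n) K) (hpc : ∀ a ∈ A, Converges s (p a))
    (hp : ∀ a ∈ A, StrictLead s (p a) a) :
    ∃ δ > 0, ∀ f, Converges s f → ∃ (q : (Fin n →₀ ℕ) → MvPowerSeries (Fin n) K)
      (ρ : MvPowerSeries (Fin n) K), (∀ a ∈ A, Converges s (q a)) ∧ Converges s ρ ∧
      (∀ a ∈ A, ∀ i, a ≤ i → MvPowerSeries.coeff i ρ = 0) ∧ f = ρ + ∑ a ∈ A, q a * p a ∧
      ∀ B, GaussGE s B f → ∀ i, (∀ a ∈ A, ¬ a ≤ i) → MvPowerSeries.coeff i (f - ρ) ≠ 0 →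
        B + δ ≤ termVal s (MvPowerSeries.coeff i (f - ρ)) i := by
  have hgap : ∀ a, ∃ δ > 0, a ∈ A →
      GaussGE s (termVal s (MvPowerSeries.coeff a (p a)) a + δ) (tail a (p a)) := by
    intro a
    by_cases ha : a ∈ A
    · obtain ⟨δ, h0, h⟩ := (hp a ha).exists_gap (hpc a ha)
      exact ⟨δ, h0, fun _ => h⟩
    · exact ⟨1, one_pos, fun h => absurd h ha⟩
  choose d hd0 hd using hgap
  -- A common `δ` strictly between `0` and all gaps; this form also covers empty `A`.
  obtain ⟨δ, hδ, hδd⟩ := Set.Finite.exists_between' (Set.finite_singleton (0 : ℚ))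
    (A.finite_toSet.image d) (by
      rintro _ rfl _ ⟨a, -, rfl⟩
      exact hd0 a)
  have hδ : 0 < δ := hδ 0 rfl
  have hσ : ∀ i, ∃ a, (∃ a ∈ A, a ≤ i) → a ∈ A ∧ a ≤ i := by
    intro i
    by_cases h : ∃ a ∈ A, a ≤ i
    · exact h.imp fun _ ha _ => ha
    · exact ⟨0, fun h' => absurd h' h⟩
  choose σ hσ using hσ
  set c : (Fin n →₀ ℕ) → K := fun a => MvPowerSeries.coeff a (p a)
  have hc : ∀ a ∈ A, c a ≠ 0 := fun a ha => (hp a ha).1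
  -- Monomial division of `h` by the leading terms has error `-T h` when the full `p a` are used.
  -- Solving `h = f + T h` therefore divides `f` exactly.
  let T : MvPowerSeries (Fin n) K →+ MvPowerSeries (Fin n) K :=
    -∑ a ∈ A, (AddMonoidHom.mulRight (tail a (p a))).comp (partialQuotient σ a (c a))
  have hTapp : ∀ h, T h = -∑ a ∈ A, partialQuotient σ a (c a) h * tail a (p a) := by
    intro h
    simp [T, AddMonoidHom.finsetSum_apply]
  refine ⟨δ, hδ, fun f hf => ?_⟩
  obtain ⟨h, hh, hfix, hB⟩ := exists_eq_add_contraction (r := s) T hδ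
    (fun B f hB => by
      rw [hTapp]
      refine (GaussGE.sum fun a ha =>
        ((hB.partialQuotient σ a (hc a ha)).mul (hd a ha)).mono ?_).neg
      have := hδd _ ⟨a, ha, rfl⟩
      simp only [c]
      linarith)
    (fun f hf => by
      rw [hTapp]
      exact (Converges.sum fun a ha =>
        (hf.partialQuotient σ a (hc a ha)).mul ((hpc a ha).tail a)).neg) f hf
  refine ⟨fun a => partialQuotient σ a (c a) h, reducedPart A h,
    fun a ha => hh.partialQuotient σ a (hc a ha), hh.reducedPart A, fun a ha i hi => ?_, ?_, ?_⟩
  · rw [coeff_reducedPart, if_pos ⟨a, ha, hi⟩]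
  · have h1 := reducedPart_add_sum A σ hσ c hc h
    have h2 : ∀ a, p a = MvPowerSeries.monomial a (c a) + tail a (p a) := fun a => by
      rw [tail, add_sub_cancel]
    calc f = h - T h := by rw [eq_sub_iff_add_eq, ← hfix]
      _ = (reducedPart A h + ∑ a ∈ A, partialQuotient σ a (c a) h *
            MvPowerSeries.monomial a (c a)) +
          ∑ a ∈ A, partialQuotient σ a (c a) h * tail a (p a) := by
        rw [h1, hTapp, sub_neg_eq_add]
      _ = _ := by
        rw [add_assoc, ← Finset.sum_add_distrib]
        congr 1
        refine Finset.sum_congr rfl fun a _ => ?_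
        rw [← mul_add, ← h2]
  · intro B hfB i hi hne
    have hE : ¬ ∃ a ∈ A, a ≤ i := fun ⟨a, ha, hai⟩ => hi a ha hai
    -- Off the exponents above `A` the remainder agrees with `h`, so `f - ρ` is there `-T h`, whose
    -- valuation gained `δ`.
    have e : MvPowerSeries.coeff i (f - reducedPart A h) = MvPowerSeries.coeff i (-T h) := by
      rw [map_sub, coeff_reducedPart, if_neg hE, ← map_sub, eq_sub_of_add_eq hfix.symm]
      congr 1
      abel
    rw [e] at hne ⊢
    exact (hB B hfB).neg i hne

/-- Let `p a ∈ I`, for `a` in the finite set `A`, have at `s` a single term of minimal Gauss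
valuation, with exponent `a`, and suppose that `A` generates the leading exponents of `I_r`,
where `r ≤ s`. Then `I_s` contains the elements of `K{X; s}` that lie in `I_r`, and `A` generates
the exponents of all their terms of minimal Gauss valuation. -/
theorem mem_completedIdeal_of_restrict [CompleteSpace K] {r s : Fin n → ℚ} (hrs : r ≤ s)
    (m : MonomialOrder (Fin n)) {I : Ideal (MvPolynomial (Fin n) K)} (A : Finset (Fin n →₀ ℕ))
    (hA : ∀ f ∈ completedIdeal r I, ∀ i,
      IsLeadingExponent r m (f : MvPowerSeries (Fin n) K) i → ∃ a ∈ A, a ≤ i)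
    (p : (Fin n →₀ ℕ) → MvPolynomial (Fin n) K) (hpI : ∀ a ∈ A, p a ∈ I)
    (hp : ∀ a ∈ A, StrictLead s (p a : MvPowerSeries (Fin n) K) a) (f : tateAlgebra K s)
    (hf : restrictTate hrs f ∈ completedIdeal r I) :
    f ∈ completedIdeal s I ∧ ∀ i, MvPowerSeries.coeff i f.1 ≠ 0 →
      (∀ j, MvPowerSeries.coeff j f.1 ≠ 0 →
        termVal s (MvPowerSeries.coeff i f.1) i ≤ termVal s (MvPowerSeries.coeff j f.1) j) →
      ∃ a ∈ A, a ≤ i := by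
  obtain ⟨δ, hδ, hdiv⟩ := exists_division A (fun a => (p a : MvPowerSeries (Fin n) K))
    (fun a _ => converges_coe s (p a)) hp
  obtain ⟨q, ρ, hq, hρ, hρA, hfq, hB⟩ := hdiv f.1 f.2
  have hq' : ∀ a, ∃ u : tateAlgebra K s, a ∈ A → u.1 = q a := by
    intro a
    by_cases ha : a ∈ A
    · exact ⟨⟨q a, hq a ha⟩, fun _ => rfl⟩
    · exact ⟨0, fun h => absurd h ha⟩
  choose u hu using hq'
  let g : tateAlgebra K s := ∑ a ∈ A, u a * polyToTate s (p a)
  have hg : g ∈ completedIdeal s I :=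
    Ideal.sum_mem _ fun a ha => Ideal.mul_mem_left _ _ (polyToTate_mem s (hpI a ha))
  have hgc : g.1 = ∑ a ∈ A, q a * (p a : MvPowerSeries (Fin n) K) := by
    simp only [g, AddSubmonoidClass.coe_finsetSum]
    refine Finset.sum_congr rfl fun a ha => ?_
    rw [Subring.coe_mul, hu a ha, coe_polyToTate]
  have hfg : f.1 - g.1 = ρ := by rw [hfq, hgc, add_sub_cancel_right]
  have hmem : restrictTate hrs (f - g) ∈ completedIdeal r I := by
    rw [map_sub]
    exact Ideal.sub_mem _ hf (restrictTate_mem hrs hg)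
  have hcoe : (restrictTate hrs (f - g)).1 = ρ := hfg
  have hρ0 : ρ = 0 := by
    by_contra hne
    obtain ⟨i, hi⟩ := exists_isLeadingExponent r m (hρ.anti hrs) hne
    obtain ⟨a, ha, hai⟩ := hA _ hmem i (by rw [hcoe]; exact hi)
    exact hi.1 (hρA a ha i hai)
  refine ⟨?_, fun i hi hmin => ?_⟩
  · have : f = g := Subtype.ext (sub_eq_zero.1 (hfg.trans hρ0))
    rwa [this]
  · by_contra! hno
    -- With `ρ = 0`, a minimal term outside the exponents above `A` would have valuation at least
    -- its own plus `δ`.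
    have := hB _ hmin i hno (by rwa [hρ0, sub_zero])
    rw [hρ0, sub_zero] at this
    linarith

end Division

/-! ### Leading terms and initial parts from generating exponents -/

section LeadingTerms

variable {K : Type*} [Field K] [Valued K ℤᵐ⁰] {n : ℕ}

/-- Multiplying by a monomial realises every exponent above `A` with any nonzero coefficient. The
resulting set depends on `A` alone, so orders sharing `A` are equivalent. -/
theorem leadingTerms_eq {r : Fin n → ℚ} {m : MonomialOrder (Fin n)}
    {I : Ideal (MvPolynomial (Fin n) K)} (A : Set (Fin n →₀ ℕ))
    (h1 : ∀ a ∈ A, ∃ p ∈ I, IsLeadingExponent r m (p : MvPowerSeries (Fin n) K) a)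
    (h2 : ∀ p ∈ I, ∀ i, IsLeadingExponent r m (p : MvPowerSeries (Fin n) K) i → ∃ a ∈ A, a ≤ i) :
    leadingTerms r m I = {t | ∃ (i : Fin n →₀ ℕ) (c : K), (c ≠ 0 → ∃ a ∈ A, a ≤ i) ∧
      MvPolynomial.monomial i c = t} := by
  ext t
  constructor
  · rintro ⟨p, hp, rfl⟩
    by_cases h0 : p = 0
    · refine ⟨0, 0, fun h => absurd rfl h, ?_⟩
      simp [h0, leadingTerm_zero]
    · obtain ⟨i, hi⟩ := exists_isLeadingExponent r m (converges_coe r p) (by simpa using h0)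
      exact ⟨i, _, fun _ => h2 p hp i hi, (leadingTerm_eq hi).symm⟩
  · rintro ⟨i, c, hc, rfl⟩
    by_cases h0 : c = 0
    · refine ⟨0, I.zero_mem, ?_⟩
      simp [h0, leadingTerm_zero]
    · obtain ⟨a, ha, hai⟩ := hc h0
      obtain ⟨p, hp, hpa⟩ := h1 a ha
      obtain ⟨b, rfl⟩ := exists_add_of_le hai
      have hc' : c / MvPowerSeries.coeff a (p : MvPowerSeries (Fin n) K) ≠ 0 :=
        div_ne_zero h0 hpa.1
      refine ⟨MvPolynomial.monomial b (c / MvPowerSeries.coeff a (p : MvPowerSeries (Fin n) K)) * p,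
        I.mul_mem_left _ hp, ?_⟩
      have := hpa.monomial_mul b hc'
      simp only [MvPolynomial.coe_mul, MvPolynomial.coe_monomial]
      rw [leadingTerm_eq this, add_comm a b]
      congr 1
      rw [MvPowerSeries.coeff_monomial_mul, if_pos le_self_add, add_tsub_cancel_left,
        div_mul_cancel₀ _ hpa.1]

theorem StrictLead.initialPart_eq {s : Fin n → ℚ} {p : MvPolynomial (Fin n) K} {a : Fin n →₀ ℕ}
    (h : StrictLead s (p : MvPowerSeries (Fin n) K) a) :
    initialPart s p = MvPolynomial.monomial a (p.coeff a) := by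
  classical
  have h0 := h.1
  have h1 := h.2
  simp only [MvPolynomial.coeff_coe] at h0 h1
  have e : (p.support.filter fun i => ∀ j ∈ p.support,
      termVal s (p.coeff i) i ≤ termVal s (p.coeff j) j) = {a} := by
    ext i
    simp only [Finset.mem_filter, MvPolynomial.mem_support_iff, Finset.mem_singleton]
    constructor
    · rintro ⟨hi, hmin⟩
      by_contra hne
      exact absurd (h1 i hne hi) (not_lt.2 (hmin a h0))
    · rintro rfl
      refine ⟨h0, fun j hj => ?_⟩
      by_cases hji : j = i
      · rw [hji]
      · exact (h1 j hji hj).le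
  rw [initialPart]
  convert Finset.sum_singleton _ a using 2

end LeadingTerms

/-! ### The two assertions -/

section Main

variable {K : Type*} [Field K] [Valued K ℤᵐ⁰] {n : ℕ}

theorem IsLocalGroebnerBasis.exists_le {r : Fin n → ℚ} {m : MonomialOrder (Fin n)}
    {I : Ideal (MvPolynomial (Fin n) K)} {G : Set (MvPolynomial (Fin n) K)}
    (hG : IsLocalGroebnerBasis r m I G) {f : tateAlgebra K r} (hf : f ∈ completedIdeal r I)
    {i : Fin n →₀ ℕ} (hi : IsLeadingExponent r m (f : MvPowerSeries (Fin n) K) i) :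
    ∃ g ∈ G, ∃ a, IsLeadingExponent r m (g : MvPowerSeries (Fin n) K) a ∧ a ≤ i := by
  obtain ⟨_, ⟨g, hg, rfl⟩, hdvd⟩ := hG.2 f hf (by
    rintro rfl
    exact hi.1 (map_zero _))
  exact ⟨g, hg, exists_leadingExponent_le (converges_coe r g) hi hdvd⟩

theorem isLocalGroebnerBasis_of_exists_le {r : Fin n → ℚ} {m : MonomialOrder (Fin n)}
    {I : Ideal (MvPolynomial (Fin n) K)} {G : Set (MvPolynomial (Fin n) K)}
    (hG : ∀ g ∈ G, polyToTate r g ∈ completedIdeal r I)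
    (h : ∀ f ∈ completedIdeal r I, ∀ i, IsLeadingExponent r m (f : MvPowerSeries (Fin n) K) i →
      ∃ g ∈ G, ∃ a, IsLeadingExponent r m (g : MvPowerSeries (Fin n) K) a ∧ a ≤ i) :
    IsLocalGroebnerBasis r m I G := by
  refine ⟨?_, fun f hf h0 => ?_⟩
  · rintro _ ⟨g, hg, rfl⟩
    exact hG g hg
  · obtain ⟨i, hi⟩ := exists_isLeadingExponent r m f.2 fun h => h0 (Subtype.ext h)
    obtain ⟨g, hg, a, ha, hai⟩ := h f hf i hi
    exact ⟨_, ⟨g, hg, rfl⟩, (leadingTerm_dvd_iff ha hi).2 hai⟩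

/-- The tie-break order of a local Gröbner basis can be absorbed in the log-radii. -/
theorem IsLocalGroebnerBasis.exists_logRadii [CompleteSpace K] {r : Fin n → ℚ}
    {m₁ : MonomialOrder (Fin n)} {I : Ideal (MvPolynomial (Fin n) K)}
    {G : Set (MvPolynomial (Fin n) K)} (hG : IsLocalGroebnerBasis r m₁ I G) :
    ∃ s : Fin n → ℚ, ∀ m₂ : MonomialOrder (Fin n), IsLocalGroebnerBasis s m₂ I G ∧
      OrdersEquivalent r m₁ s m₂ I ∧ leadingIdeal s m₂ I = initialIdeal s I := by
  obtain ⟨A, hAG, hA⟩ := exists_finite_subset_le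
    {a | ∃ g ∈ G, IsLeadingExponent r m₁ (g : MvPowerSeries (Fin n) K) a}
  have hGr : ∀ g ∈ G, polyToTate r g ∈ completedIdeal r I := fun g hg => hG.1 ⟨g, hg, rfl⟩
  -- `G` lies only in `I_r`, so its elements are not yet known to be in `I_s`; the divisors `p a`
  -- are taken from `I` instead.
  have hchoice : ∀ a, ∃ g p : MvPolynomial (Fin n) K, a ∈ A →
      g ∈ G ∧ IsLeadingExponent r m₁ (g : MvPowerSeries (Fin n) K) a ∧
      p ∈ I ∧ IsLeadingExponent r m₁ (p : MvPowerSeries (Fin n) K) a := by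
    intro a
    by_cases ha : a ∈ A
    · obtain ⟨g, hg, hga⟩ := hAG ha
      obtain ⟨p, hp, hpa⟩ := exists_mem_isLeadingExponent (hGr g hg) hga
      exact ⟨g, p, fun _ => ⟨hg, hga, hp, hpa⟩⟩
    · exact ⟨0, 0, fun h => absurd h ha⟩
  choose g p hgp using hchoice
  obtain ⟨s, hrs, hs⟩ := exists_strictLead r m₁ (g '' A ∪ p '' A)
    ((A.finite_toSet.image g).union (A.finite_toSet.image p))
  have hgs : ∀ a ∈ A, StrictLead s (g a : MvPowerSeries (Fin n) K) a := fun a ha =>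
    hs _ (Or.inl ⟨a, ha, rfl⟩) a (hgp a ha).2.1
  have hps : ∀ a ∈ A, StrictLead s (p a : MvPowerSeries (Fin n) K) a := fun a ha =>
    hs _ (Or.inr ⟨a, ha, rfl⟩) a (hgp a ha).2.2.2
  have hpI : ∀ a ∈ A, p a ∈ I := fun a ha => (hgp a ha).2.2.1
  have hAr : ∀ f ∈ completedIdeal r I, ∀ i,
      IsLeadingExponent r m₁ (f : MvPowerSeries (Fin n) K) i → ∃ a ∈ A, a ≤ i := by
    intro f hf i hi
    obtain ⟨g, hg, a, ha, hai⟩ := hG.exists_le hf hi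
    obtain ⟨b, hb, hba⟩ := hA a ⟨g, hg, ha⟩
    exact ⟨b, hb, hba.trans hai⟩
  have key := mem_completedIdeal_of_restrict hrs m₁ A hAr p hpI hps
  -- All minimal terms are covered, not only the leading one; this puts every term of an initial
  -- part in the leading ideal.
  have hAs : ∀ p ∈ I, ∀ i, p.coeff i ≠ 0 → (∀ j, p.coeff j ≠ 0 →
      termVal s (p.coeff i) i ≤ termVal s (p.coeff j) j) → ∃ a ∈ A, a ≤ i := fun p hp =>
    by simpa using (key (polyToTate s p) (restrictTate_mem hrs (polyToTate_mem s hp))).2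
  refine ⟨s, fun m₂ => ?_⟩
  have hLT : leadingTerms s m₂ I = {t | ∃ (i : Fin n →₀ ℕ) (c : K),
      (c ≠ 0 → ∃ a ∈ (A : Set (Fin n →₀ ℕ)), a ≤ i) ∧ MvPolynomial.monomial i c = t} := by
    refine leadingTerms_eq (A : Set (Fin n →₀ ℕ))
      (fun a ha => ⟨p a, hpI a ha, (hps a ha).isLeadingExponent m₂⟩) fun p hp i hi => ?_
    refine hAs p hp i (by simpa using hi.1) fun j hj => ?_
    simpa using hi.termVal_le j (by simpa using hj)
  refine ⟨isLocalGroebnerBasis_of_exists_le (fun g hg => ?_) fun f hf i hi => ?_, ?_, ?_⟩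
  · exact (key (polyToTate s g) (hGr g hg)).1
  · obtain ⟨a, ha, hai⟩ := (key f (restrictTate_mem hrs hf)).2 i hi.1 hi.termVal_le
    exact ⟨g a, (hgp a ha).1, a, (hgs a ha).isLeadingExponent m₂, hai⟩
  · rw [OrdersEquivalent, hLT]
    exact leadingTerms_eq (A : Set (Fin n →₀ ℕ))
      (fun a ha => ⟨p a, hpI a ha, (hgp a ha).2.2.2⟩) fun p hp i hi =>
      hAr _ (polyToTate_mem r hp) i hi
  · refine le_antisymm (Ideal.span_le.2 ?_) (Ideal.span_le.2 ?_)
    · rw [hLT]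
      rintro _ ⟨i, c, hc, rfl⟩
      by_cases h0 : c = 0
      · simp [h0]
      · obtain ⟨a, ha, hai⟩ := hc h0
        refine Ideal.mem_of_dvd _ ?_ (Ideal.subset_span ⟨p a, hpI a ha, rfl⟩)
        rw [(hps a ha).initialPart_eq, MvPolynomial.monomial_dvd_monomial]
        exact ⟨Or.inr hai, (IsUnit.mk0 _ (by simpa using (hps a ha).1)).dvd⟩
    · rintro _ ⟨p, hp, rfl⟩
      refine Ideal.sum_mem _ fun i hi => Ideal.subset_span ?_
      rw [Finset.mem_filter] at hi
      rw [hLT]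
      exact ⟨i, _, fun h => hAs p hp i h fun j hj =>
        hi.2 j (MvPolynomial.mem_support_iff.2 hj), rfl⟩

/-- A universal analytic Gröbner basis is one for any choice of tie-break orders. -/
theorem IsUniversalAnalyticGroebnerBasis.change_order
    {m : (Fin n → ℚ) → MonomialOrder (Fin n)} {I : Ideal (MvPolynomial (Fin n) K)}
    {G : Set (MvPolynomial (Fin n) K)} (hG : IsUniversalAnalyticGroebnerBasis m I G)
    (m' : (Fin n → ℚ) → MonomialOrder (Fin n)) : IsUniversalAnalyticGroebnerBasis m' I G := by
  obtain ⟨hfin, hGI, hloc⟩ := hG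
  refine ⟨hfin, hGI, fun r => isLocalGroebnerBasis_of_exists_le
    (fun g hg => polyToTate_mem r (hGI hg)) fun f hf i hi => ?_⟩
  obtain ⟨p, hp, hpi⟩ := exists_mem_isLeadingExponent hf hi
  -- Finiteness of `G` lets one `s` serve `p` and all of `G`, before it is known which `g` will
  -- divide.
  obtain ⟨s, -, hs⟩ := exists_strictLead r (m' r) (insert p G) (hfin.insert p)
  obtain ⟨g, hg, a, ha, hai⟩ := (hloc s).exists_le (polyToTate_mem s hp)
    ((hs p (Set.mem_insert _ _) i hpi).isLeadingExponent (m s))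
  obtain ⟨b, hb⟩ := exists_isLeadingExponent r (m' r) (converges_coe r g) (by
    rintro h
    rw [h] at ha
    exact ha.1 (map_zero _))
  have hba : b = a :=
    ((hs g (Set.mem_insert_of_mem _ hg) b hb).isLeadingExponent (m s)).unique ha
  exact ⟨g, hg, b, hb, hba ▸ hai⟩

end Main

end TateGB

theorem mainTheorem3 {K : Type*} [Field K] [Valued K ℤᵐ⁰] [CompleteSpace K]
    (π : K) (hπ : Valued.v π = WithZero.exp (-1 : ℤ)) {n : ℕ}
    (I : Ideal (MvPolynomial (Fin n) K)) (G : Set (MvPolynomial (Fin n) K)) :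
    (∀ (r : Fin n → ℚ) (m₁ : MonomialOrder (Fin n)), TateGB.IsLocalGroebnerBasis r m₁ I G →
      ∃ s : Fin n → ℚ, ∀ m₂ : MonomialOrder (Fin n),
        TateGB.IsLocalGroebnerBasis s m₂ I G ∧
        TateGB.OrdersEquivalent r m₁ s m₂ I ∧
        TateGB.leadingIdeal s m₂ I = TateGB.initialIdeal s I) ∧
    (∀ m m' : (Fin n → ℚ) → MonomialOrder (Fin n),
      TateGB.IsUniversalAnalyticGroebnerBasis m I G →
        TateGB.IsUniversalAnalyticGroebnerBasis m' I G) := by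
  exact ⟨fun r m₁ hG => hG.exists_logRadii, fun m m' hG => hG.change_order m'⟩
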